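/- Let $A$ be a finite-dimensional algebra over a field $k$, and let $A\text{-mod}$ be the category of finitely generated left $A$-modules. A module in $A\text{-mod}$ is Gorenstein projective if it is isomorphic to $\ker d^0$ for some exact complex $P^\bullet$ of finitely generated projective $A$-modules such that $\mathrm{Hom}_A(P^\bullet,Q)$ is exact for every finitely generated projective $A$-module $Q$. Assume that $A$ is of finite CM-type, i.e. there are, up to isomorphism, only finitely many indecomposable Gorenstein projective modules $G_1,\dots,G_s$ in $A\text{-mod}$, and put $G=\bigoplus_i G_i$. Let $\nu=\mathrm{Hom}_k(\mathrm{Hom}_A(-,A),k)$ be the Nakayama functor. For $M\in A\text{-mod}$ let $\mathrm{add}\,M$ be the class of direct summands of finite direct sums of copies of $M$. For $M,X\in A\text{-mod}$ let $M\text{-resol.dim}\,X\in\{0,1,2,\dots,\infty\}$ be the least $n\ge 0$ such that there is an exact sequence $0\to M_n\to\cdots\to M_0\to X\to 0$ with all $M_i\in\mathrm{add}\,M$ that stays exact under $\mathrm{Hom}_A(M,-)$ (and $\infty$ if there is none), and let $M\text{-resol.dim}(A\text{-mod})=\sup_{X} M\text{-resol.dim}\,X$. The Gorenstein representation dimension of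 $A$ is $$\mathrm{Grepdim}\,A=\min\{M\text{-resol.dim}(A\text{-mod})\mid M\in A\text{-mod},\ G\oplus\nu(G)\in\mathrm{add}\,M\}+2,$$ and a module $M$ realizing this minimum is called a Gorenstein Auslander generator. Let $D^b_{gp}(A)$ be the bounded Gorenstein derived category, i.e. the Verdier quotient of the bounded homotopy category $K^b(A\text{-mod})$ by the triangulated subcategory of the complexes $C^\bullet$ such that $\mathrm{Hom}_A(E,C^\bullet)$ is exact for every Gorenstein projective $E\in A\text{-mod}$; modules are regarded as complexes concentrated in degree $0$. For an object $M$ of a triangulated category $\mathcal T$ let $\langle M\rangle_1=\mathrm{add}\{M[i]\mid i\in\mathbb Z\}$, let $\langle M\rangle_{n+1}=\mathrm{add}\{X\mid \text{there is a distinguished triangle } M'\to X\to M''\to M'[1] \text{ with } M'\in\langle M\rangle_1,\ M''\in\langle M\rangle_n\}$ for $n\ge 1$, and for a subcategory $\mathcal C\subseteq\mathcal T$ let $\dim_{\mathcal T}\mathcal C=\inf\{n\ge 0\mid \exists M\in\mathcal T:\ \mathcal C\subseteq\langle M\rangle_{n+1}\}$. Theorem. Let $M$ be a Gorenstein Auslander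 generator, $X\in A\text{-mod}$ and $n\ge 0$ an integer. Then $$M\text{-resol.dim}\,X\le n\ \Longrightarrow\ X\in\langle M\rangle_{n+1}\ \text{ in } D^b_{gp}(A).$$ In particular (in $\{0,1,2,\dots,\infty\}$) $$\mathrm{Grepdim}\,A\ \ge\ \dim_{D^b_{gp}(A)}(A\text{-mod})+2 .$$ -/

import Mathlib

open CategoryTheory Limits Pretriangulated ZeroObject

universe u

noncomputable section

namespace GorensteinDim

/-! ### The additive category `A-mod` of finitely generated left modules -/

section FinitelyGenerated

variable (A : Type u) [Ring A]

instance isFG_containsZero : (ModuleCat.isFG.{u} A).ContainsZero where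
  exists_zero := ⟨ModuleCat.of A PUnit.{u + 1}, ModuleCat.isZero_of_subsingleton _, by
    rw [ModuleCat.isFG_iff]; infer_instance⟩

instance isFG_isClosedUnderIsomorphisms :
    (ModuleCat.isFG.{u} A).IsClosedUnderIsomorphisms where
  of_iso {X Y} e (hX : Module.Finite A X) := by
    rw [ModuleCat.isFG_iff]
    exact Module.Finite.equiv e.toLinearEquiv

instance isFG_isClosedUnderFiniteProducts :
    (ModuleCat.isFG.{u} A).IsClosedUnderFiniteProducts where
  isClosedUnderLimitsOfShape J _ := by
    refine ⟨?_⟩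
    rintro X ⟨p⟩
    let F : J → ModuleCat.{u} A := fun j => p.diag.obj ⟨j⟩
    have : ∀ j, Module.Finite A (F j) := fun j => p.prop_diag_obj ⟨j⟩
    have h : ModuleCat.isFG.{u} A (∏ᶜ F) := by
      rw [ModuleCat.isFG_iff]; infer_instance
    have e₁ : (∏ᶜ F) ≅ limit p.diag := HasLimit.isoOfNatIso (Discrete.natIso fun _ => Iso.refl _)
    have e₂ : X ≅ limit p.diag := p.isLimit.conePointUniqueUpToIso (limit.isLimit p.diag)
    exact (ModuleCat.isFG.{u} A).prop_of_iso (e₁ ≪≫ e₂.symm) h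

instance fgModuleCat_hasFiniteBiproducts : HasFiniteBiproducts (FGModuleCat.{u} A) :=
  HasFiniteBiproducts.of_hasFiniteProducts

instance fgModuleCat_hasBinaryBiproducts : HasBinaryBiproducts (FGModuleCat.{u} A) :=
  hasBinaryBiproducts_of_finite_biproducts _

instance fgModuleCat_hasZeroObject : HasZeroObject (FGModuleCat.{u} A) :=
  inferInstance

end FinitelyGenerated

/-! ### Bounded homotopy categories -/

section Bounded

variable (C : Type*) [Category* C] [Preadditive C]

/-- A cochain complex is bounded if its terms vanish in degrees `< a` and in degrees `> b`,
for some integers `a`, `b`. -/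
def IsBoundedComplex (K : CochainComplex C ℤ) : Prop :=
  (∃ a : ℤ, K.IsStrictlyGE a) ∧ ∃ b : ℤ, K.IsStrictlyLE b

/-- The bounded complexes, as a property of objects of the homotopy category `K(C)`. -/
def bounded : ObjectProperty (HomotopyCategory C (.up ℤ)) :=
  fun K => IsBoundedComplex C K.as

variable {C} in
lemma bounded_quotient_obj_iff (K : CochainComplex C ℤ) :
    bounded C ((HomotopyCategory.quotient _ _).obj K) ↔ IsBoundedComplex C K := Iff.rfl

instance bounded_containsZero [HasZeroObject C] : (bounded C).ContainsZero where
  exists_zero := by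
    refine ⟨(HomotopyCategory.quotient _ _).obj 0, Functor.map_isZero _ (isZero_zero _), ?_⟩
    rw [bounded_quotient_obj_iff]
    exact ⟨⟨0, inferInstance⟩, ⟨0, inferInstance⟩⟩

instance bounded_isStableUnderShift : (bounded C).IsStableUnderShift ℤ where
  isStableUnderShiftBy n :=
    { le_shift K hK := by
        obtain ⟨K : CochainComplex _ _, rfl⟩ := K.quotient_obj_surjective
        rw [bounded_quotient_obj_iff] at hK
        obtain ⟨⟨a, _⟩, ⟨b, _⟩⟩ := hK
        rw [ObjectProperty.prop_shift_iff, HomotopyCategory.shift_quotient_obj,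
          bounded_quotient_obj_iff]
        exact ⟨⟨a - n, K.isStrictlyGE_shift a n (a - n) (by lia)⟩,
          ⟨b - n, K.isStrictlyLE_shift b n (b - n) (by lia)⟩⟩ }

lemma isBoundedComplex_mappingCone [HasBinaryBiproducts C] {K L : CochainComplex C ℤ}
    (f : K ⟶ L) (hK : IsBoundedComplex C K) (hL : IsBoundedComplex C L) :
    IsBoundedComplex C (CochainComplex.mappingCone f) := by
  obtain ⟨⟨a, _⟩, ⟨b, _⟩⟩ := hK
  obtain ⟨⟨a', _⟩, ⟨b', _⟩⟩ := hL
  refine ⟨⟨min (a - 1) a', CochainComplex.isStrictlyGE_mappingCone f a a' _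
    (by simp) (by simp)⟩, ⟨max b b', ?_⟩⟩
  rw [CochainComplex.isStrictlyLE_iff]
  intro i hi
  simp only [sup_lt_iff] at hi
  simp only [CochainComplex.mappingCone.isZero_X_iff]
  exact ⟨K.isZero_of_isStrictlyLE b _, L.isZero_of_isStrictlyLE b' _⟩

instance bounded_isTriangulatedClosed₃ [HasZeroObject C] [HasBinaryBiproducts C] :
    (bounded C).IsTriangulatedClosed₃ where
  ext₃' T hT h₁ h₂ := by
    obtain ⟨f : T.obj₁.as ⟶ T.obj₂.as, hf⟩ :=
      (HomotopyCategory.quotient _ _).map_surjective T.mor₁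
    refine ⟨_, isBoundedComplex_mappingCone C f h₁ h₂,
      ⟨Triangle.π₃.mapIso (isoTriangleOfIso₁₂ T _ hT
        (HomotopyCategory.mappingCone_triangleh_distinguished f)
        (Iso.refl _) (Iso.refl _) ?_)⟩⟩
    exact (Category.comp_id _).trans (hf.symm.trans (Category.id_comp _).symm)

instance bounded_isTriangulated [HasZeroObject C] [HasBinaryBiproducts C] :
    (bounded C).IsTriangulated where
  toIsTriangulatedClosed₂ := .of_isTriangulatedClosed₃

/-- The bounded homotopy category `K^b(C)`. -/
abbrev BoundedHomotopyCategory := (bounded C).FullSubcategory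

/-- The functor `C ⥤ K^b(C)` sending an object to the complex concentrated in degree `0`. -/
def boundedSingle [HasZeroObject C] : C ⥤ BoundedHomotopyCategory C :=
  (bounded C).lift (HomotopyCategory.singleFunctor C 0) (fun X => by
    rw [← HomotopyCategory.quotient_obj_singleFunctors_obj, bounded_quotient_obj_iff]
    exact ⟨⟨0, inferInstance⟩, ⟨0, inferInstance⟩⟩)

end Bounded

/-! ### Gorenstein projective modules and finite CM-type -/

section Gorenstein

variable {A : Type u} [Ring A]

/-- A totally acyclic complex of finitely generated projective modules: an exact complex `P` of
finitely generated projective modules such that `Hom_A(P, Q)` is exact for every finitely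
generated projective module `Q`. -/
structure IsTotallyAcyclic (P : CochainComplex (FGModuleCat.{u} A) ℤ) : Prop where
  projective : ∀ i, Module.Projective A (P.X i)
  exact : ∀ i j k : ℤ, i + 1 = j → j + 1 = k →
    Function.Exact (P.d i j).hom.hom (P.d j k).hom.hom
  hom_exact : ∀ Q : FGModuleCat.{u} A, Module.Projective A Q →
    ∀ i j k : ℤ, i + 1 = j → j + 1 = k → ∀ f : P.X j ⟶ Q, P.d i j ≫ f = 0 →
      ∃ g : P.X k ⟶ Q, P.d j k ≫ g = f

/-- Gorenstein projective objects of `A-mod`: modules isomorphic to `Ker d⁰` for some totally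
acyclic complex of finitely generated projective modules. -/
def IsGorensteinProjective (G : FGModuleCat.{u} A) : Prop :=
  ∃ P : CochainComplex (FGModuleCat.{u} A) ℤ, IsTotallyAcyclic P ∧
    Nonempty (G ≃ₗ[A] LinearMap.ker (P.d 0 1).hom.hom)

/-- `G₁, …, G_s` is a complete list, without repetition, of the indecomposable finitely generated
Gorenstein projective modules up to isomorphism. -/
structure IsIndecGprojList {s : ℕ} (G : Fin s → FGModuleCat.{u} A) : Prop where
  gorensteinProjective : ∀ i, IsGorensteinProjective (G i)
  indecomposable : ∀ i, Indecomposable (G i)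
  eq_of_iso : ∀ i j, Nonempty (G i ≅ G j) → i = j
  exists_iso : ∀ X : FGModuleCat.{u} A, IsGorensteinProjective X → Indecomposable X →
    ∃ i, Nonempty (X ≅ G i)

variable (A) in
/-- Finite CM-type: there are only finitely many isomorphism classes of indecomposable finitely
generated Gorenstein projective modules. -/
def IsFiniteCMType : Prop :=
  ∃ (s : ℕ) (G : Fin s → FGModuleCat.{u} A), IsIndecGprojList G

/-- The direct sum `G` of all indecomposable finitely generated Gorenstein projective modules,
one from each isomorphism class. -/
def IsFiniteCMType.gprojSum (hA : IsFiniteCMType A) : FGModuleCat.{u} A :=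
  ⨁ hA.choose_spec.choose

end Gorenstein

/-! ### The Nakayama functor -/

section Nakayama

variable (k : Type u) [Field k] {A : Type u} [Ring A] [Algebra k A]

/-- The `k`-vector space `D Hom_A(M, A)`, where `D = Hom_k(-, k)`. -/
def NakayamaModule (k : Type u) [Field k] (A : Type u) [Ring A] [Algebra k A]
    (M : Type u) [AddCommGroup M] [Module A M] : Type u :=
  Module.Dual k (M →ₗ[A] A)

variable (M : Type u) [AddCommGroup M] [Module A M]

instance nakayamaAddCommGroup : AddCommGroup (NakayamaModule k A M) :=
  inferInstanceAs (AddCommGroup (Module.Dual k (M →ₗ[A] A)))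

/-- Right multiplication by `a` on the right `A`-module `Hom_A(M, A)`: `(f a)(m) = f(m) a`. -/
def homRightMul (a : A) : (M →ₗ[A] A) →ₗ[k] (M →ₗ[A] A) where
  toFun f :=
    { toFun := fun m => f m * a
      map_add' := fun x y => by rw [map_add, add_mul]
      map_smul' := fun r x => by
        rw [map_smul, RingHom.id_apply, smul_eq_mul, smul_eq_mul, mul_assoc] }
  map_add' f g := by ext m; exact add_mul _ _ _
  map_smul' c f := by ext m; exact smul_mul_assoc _ _ _

/-- The left `A`-module structure on `D Hom_A(M, A)`: `(a φ)(f) = φ(f a)`. -/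
instance nakayamaModuleStructure : Module A (NakayamaModule k A M) where
  smul a φ := LinearMap.comp (σ₁₂ := RingHom.id k) (M₃ := k) φ (homRightMul k M a)
  one_smul φ := LinearMap.ext fun f => congrArg (DFunLike.coe (F := Module.Dual k _) φ)
    (LinearMap.ext fun m => mul_one (f m))
  mul_smul a b φ := LinearMap.ext fun f => congrArg (DFunLike.coe (F := Module.Dual k _) φ)
    (LinearMap.ext fun m => (mul_assoc (f m) a b).symm)
  smul_zero _ := rfl
  smul_add _ _ _ := rfl
  add_smul a b φ := LinearMap.ext fun f =>
    (congrArg (DFunLike.coe (F := Module.Dual k _) φ)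
      (LinearMap.ext fun m => mul_add (f m) a b)).trans
        (map_add (F := Module.Dual k (M →ₗ[A] A)) φ _ _)
  zero_smul φ := LinearMap.ext fun f =>
    (congrArg (DFunLike.coe (F := Module.Dual k _) φ)
      (LinearMap.ext fun m => mul_zero (f m))).trans
        (map_zero (F := Module.Dual k (M →ₗ[A] A)) φ)

lemma nakayama_smul_apply (a : A) (φ : NakayamaModule k A M) (f : M →ₗ[A] A) :
    DFunLike.coe (F := Module.Dual k (M →ₗ[A] A)) (a • φ) f =
      DFunLike.coe (F := Module.Dual k (M →ₗ[A] A)) φ (homRightMul k M a f) := rfl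

instance nakayama_finite [Module.Finite k A] [Module.Finite A M] :
    Module.Finite A (NakayamaModule k A M) := by
  obtain ⟨n, p, hp⟩ := Module.Finite.exists_fin' A M
  let r : (M →ₗ[A] A) →ₗ[k] (Fin n → A) :=
    { toFun := fun f i => f (p (Pi.single i 1))
      map_add' := fun _ _ => rfl
      map_smul' := fun _ _ => rfl }
  have hr : Function.Injective r := by
    intro f g h
    have : f ∘ₗ p = g ∘ₗ p := by
      refine LinearMap.pi_ext' fun i => LinearMap.ext_ring ?_
      exact congrFun h i
    ext m
    obtain ⟨x, rfl⟩ := hp m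
    exact LinearMap.congr_fun this x
  have h₁ : Module.Finite k (M →ₗ[A] A) := Module.Finite.of_injective r hr
  obtain ⟨t, ht⟩ := (inferInstance : Module.Finite k (Module.Dual k (M →ₗ[A] A)))
  let t' : Finset (NakayamaModule k A M) := t
  have key : ∀ φ : Module.Dual k (M →ₗ[A] A), φ ∈ Submodule.span k (t : Set _) →
      (id φ : NakayamaModule k A M) ∈ Submodule.span A (t' : Set (NakayamaModule k A M)) := by
    intro φ hφ
    induction hφ using Submodule.span_induction with
    | mem x hx => exact Submodule.subset_span hx
    | zero => exact Submodule.zero_mem _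
    | add x y _ _ hx hy => exact Submodule.add_mem _ hx hy
    | smul c x _ hx =>
      have h := Submodule.smul_mem _ (algebraMap k A c) hx
      convert h using 1
      refine LinearMap.ext fun f => ?_
      have e : homRightMul k M (algebraMap k A c) f = c • f := by
        ext m
        exact ((Algebra.commutes c (f m)).symm.trans (Algebra.smul_def c (f m)).symm)
      refine Eq.trans ?_ (nakayama_smul_apply k M (algebraMap k A c) x f).symm
      rw [e]
      exact (LinearMap.map_smul x c f).symm
  exact ⟨⟨t', eq_top_iff.2 fun φ _ => key φ (by rw [ht]; trivial)⟩⟩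

/-- The Nakayama functor `ν = D Hom_A(-, A)`, on objects of `A-mod`. -/
def nakayama [Module.Finite k A] (M : FGModuleCat.{u} A) : FGModuleCat.{u} A :=
  FGModuleCat.of A (NakayamaModule k A M)

end Nakayama

/-! ### Resolution dimension and Gorenstein representation dimension -/

section Resolution

variable {A : Type u} [Ring A]

/-- `X ∈ add M`: `X` is a direct summand of a finite direct sum of copies of `M`. (Every retract
in `A-mod` splits off as a direct summand.) -/
def InAdd (M X : FGModuleCat.{u} A) : Prop :=
  ∃ n : ℕ, Nonempty (Retract X (⨁ fun _ : Fin n => M))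

/-- `X` has an `M`-resolution of length at most `n`: an exact sequence
`0 → M_n → ⋯ → M_1 → M_0 → X → 0` with all `M_i` in `add M` which stays exact under
`Hom_A(M, -)`. The sequence is given as a complex `K` with `K.X i = 0` for `i > n`, together with
an augmentation `ε : K.X 0 ⟶ X`. -/
def HasAddResolution (M X : FGModuleCat.{u} A) (n : ℕ) : Prop :=
  ∃ (K : ChainComplex (FGModuleCat.{u} A) ℕ) (ε : K.X 0 ⟶ X),
    (∀ i, InAdd M (K.X i)) ∧ (∀ i, n < i → IsZero (K.X i)) ∧
    Function.Surjective ε.hom.hom ∧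
    Function.Exact (K.d 1 0).hom.hom ε.hom.hom ∧
    (∀ i, Function.Exact (K.d (i + 2) (i + 1)).hom.hom (K.d (i + 1) i).hom.hom) ∧
    (∀ f : M ⟶ X, ∃ g : M ⟶ K.X 0, g ≫ ε = f) ∧
    (∀ f : M ⟶ K.X 0, f ≫ ε = 0 → ∃ g : M ⟶ K.X 1, g ≫ K.d 1 0 = f) ∧
    ∀ i, ∀ f : M ⟶ K.X (i + 1), f ≫ K.d (i + 1) i = 0 →
      ∃ g : M ⟶ K.X (i + 2), g ≫ K.d (i + 2) (i + 1) = f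

/-- `M-resol.dim X`, the least length of an `M`-resolution of `X` (`⊤` if there is none). -/
def resolDim (M X : FGModuleCat.{u} A) : ℕ∞ :=
  ⨅ (n : ℕ) (_ : HasAddResolution M X n), (n : ℕ∞)

/-- `M-resol.dim (A-mod)`, the supremum of `M-resol.dim X` over all `X` in `A-mod`. -/
def resolDimAll (M : FGModuleCat.{u} A) : ℕ∞ :=
  ⨆ X : FGModuleCat.{u} A, resolDim M X

variable (k : Type u) [Field k] [Algebra k A] [Module.Finite k A]

/-- The Gorenstein representation dimension of an algebra of finite CM-type: the minimum of
`M-resol.dim (A-mod)` over all `M` with `G ⊕ ν(G) ∈ add M`, plus `2`. -/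
def grepdim (hA : IsFiniteCMType A) : ℕ∞ :=
  (⨅ (M : FGModuleCat.{u} A) (_ : InAdd M (hA.gprojSum ⊞ nakayama k hA.gprojSum)),
    resolDimAll M) + 2

/-- `M` is a Gorenstein Auslander generator: `G ⊕ ν(G) ∈ add M`, and `M` realizes the minimum in
the definition of the Gorenstein representation dimension. -/
def IsGorensteinAuslanderGenerator (hA : IsFiniteCMType A) (M : FGModuleCat.{u} A) : Prop :=
  InAdd M (hA.gprojSum ⊞ nakayama k hA.gprojSum) ∧ resolDimAll M + 2 = grepdim k hA

end Resolution

/-! ### The bounded Gorenstein derived category -/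

section DerivedCategory

variable (A : Type u) [Ring A]

/-- The functor `K(A-mod) ⥤ K(Ab)` induced by `Hom_A(G, -)`. -/
abbrev homComplexFunctor (G : FGModuleCat.{u} A) :
    HomotopyCategory (FGModuleCat.{u} A) (.up ℤ) ⥤ HomotopyCategory AddCommGrpCat.{u} (.up ℤ) :=
  (preadditiveCoyoneda.obj (Opposite.op G)).mapHomotopyCategory (.up ℤ)

/-- The `Gproj`-acyclic complexes in `K(A-mod)`: complexes `K` such that `Hom_A(G, K)` is acyclic
for every finitely generated Gorenstein projective module `G`. -/
def gprojAcyclic : ObjectProperty (HomotopyCategory (FGModuleCat.{u} A) (.up ℤ)) :=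
  fun K => ∀ G : FGModuleCat.{u} A, IsGorensteinProjective G →
    (HomotopyCategory.subcategoryAcyclic AddCommGrpCat.{u}) ((homComplexFunctor A G).obj K)

instance gprojAcyclic_isClosedUnderIsomorphisms :
    (gprojAcyclic A).IsClosedUnderIsomorphisms where
  of_iso e h G hG := ObjectProperty.prop_of_iso _ ((homComplexFunctor A G).mapIso e) (h G hG)

instance gprojAcyclic_isTriangulated : (gprojAcyclic A).IsTriangulated where
  exists_zero := ⟨0, isZero_zero _, fun G _ =>
    ObjectProperty.prop_of_isZero _ ((homComplexFunctor A G).map_isZero (isZero_zero _))⟩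
  isStableUnderShiftBy n := ⟨fun _ hK G hG =>
    ((HomotopyCategory.subcategoryAcyclic AddCommGrpCat.{u}).inverseImage
      (homComplexFunctor A G)).le_shift n _ (hK G hG)⟩
  toIsTriangulatedClosed₂ := .mk' (fun T hT h₁ h₃ G hG =>
    ((HomotopyCategory.subcategoryAcyclic AddCommGrpCat.{u}).inverseImage
      (homComplexFunctor A G)).ext_of_isTriangulatedClosed₂ T hT (h₁ G hG) (h₃ G hG))

/-- `K^b(A-mod)`. -/
abbrev Kb := BoundedHomotopyCategory (FGModuleCat.{u} A)

/-- The triangulated subcategory of `K^b(A-mod)` of `Gproj`-acyclic bounded complexes. -/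
abbrev gprojAcyclicBounded : ObjectProperty (Kb A) :=
  (gprojAcyclic A).inverseImage (bounded (FGModuleCat.{u} A)).ι

/-- The bounded Gorenstein derived category `D^b_gp(A)`: the Verdier quotient of `K^b(A-mod)` by
the subcategory of `Gproj`-acyclic complexes, that is, the localization at the morphisms whose
cone is `Gproj`-acyclic. -/
abbrev Dbgp := (gprojAcyclicBounded A).trW.Localization

/-- The canonical functor `A-mod ⥤ D^b_gp(A)`, sending a module to the corresponding complex
concentrated in degree `0`. -/
def toDbgp : FGModuleCat.{u} A ⥤ Dbgp A :=
  boundedSingle (FGModuleCat.{u} A) ⋙ (gprojAcyclicBounded A).trW.Q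

end DerivedCategory

/-! ### Dimensions in triangulated categories -/

section Dimension

variable {T : Type*} [Category* T] [HasZeroObject T] [HasShift T ℤ] [Preadditive T]
  [∀ n : ℤ, (shiftFunctor T n).Additive] [Pretriangulated T]

/-- `⟨M⟩_{n+1}`. For `n = 0` it consists of the direct summands of finite direct sums of shifts of
`M`; then `⟨M⟩_{n+2}` consists of the direct summands of objects `X` in a distinguished triangle
`M' → X → M'' → M'[1]` with `M' ∈ ⟨M⟩_1` and `M'' ∈ ⟨M⟩_{n+1}`, as `triangEnvelopeIter_zero` and
`triangEnvelopeIter_succ` say. (In a triangulated category retracts are direct summands, and the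
objects `X` as above are closed under finite direct sums, so this is the usual closure under
`add`.) -/
abbrev level (M : T) (n : ℕ) : ObjectProperty T :=
  (ObjectProperty.singleton M).triangEnvelopeIter n

/-- The dimension of a subcategory `P` of `T`: the infimum of the `n` such that `P ⊆ ⟨M⟩_{n+1}`
for some object `M` of `T`. -/
def dimIn (P : ObjectProperty T) : ℕ∞ :=
  ⨅ (n : ℕ) (_ : ∃ M : T, P ≤ level M n), (n : ℕ∞)

end Dimension

end GorensteinDim

end

open GorensteinDim

/-!
Let `M` satisfy `G ⊕ ν(G) ∈ add M`. Then every Gorenstein projective module lies in `add M`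
(`inAdd_of_isGorensteinProjective`): it decomposes into indecomposable summands, these are
Gorenstein projective again (`isGorensteinProjective_of_retract`), hence occur in the list
`G₁, …, G_s`. That summands of Gorenstein projective modules are Gorenstein projective is proved
without Ext groups: a totally acyclic complex is the same as a bi-infinite chain of short exact
sequences `ProjStep`, and Schanuel-type arguments produce such sequences for summands.

Consequently an `M`-resolution stays exact under `Hom_A(E, -)` for every Gorenstein projective `E`,
and so do the short exact sequences `0 → Y → M₀ → X → 0` into which it breaks up. Each of them gives
a distinguished triangle of `D^b_gp(A)` (`exists_distinguished_toDbgp`), because the comparison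
`cone(Y → M₀) ⟶ X` has a `Gproj`-acyclic cone. Rotating to `M₀ → X → Y[1] → M₀[1]`, induction on the
length of the resolution gives `X ∈ ⟨M⟩_{n+1}` (`HasAddResolution.level`). The inequality follows by
taking the infimum over all such `M`.
-/

noncomputable section

namespace GorensteinDim

/-! ### Distinguished triangles from short exact sequences -/

section ConeOfShortExact

variable {C D : Type*} [Category* C] [Preadditive C] [Category* D] [Abelian D]

/-- Additive functors commute with the comparison `cone(S.f) ⟶ S.X₃`. Only the target of `F` is
assumed abelian: `A-mod` carries no such instance, so `descShortComplex` is not available there. -/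
lemma map_mappingCone_desc [HasBinaryBiproducts C] (F : C ⥤ D) [F.Additive]
    (S : ShortComplex (CochainComplex C ℤ)) :
    (F.mapHomologicalComplex (.up ℤ)).map
        (CochainComplex.mappingCone.desc S.f 0 S.g (by simp)) =
      (CochainComplex.mappingCone.mapHomologicalComplexIso S.f F).hom ≫
        CochainComplex.mappingCone.descShortComplex
          (S.map (F.mapHomologicalComplex (.up ℤ))) := by
  let S' := S.map (F.mapHomologicalComplex (.up ℤ))
  refine HomologicalComplex.hom_ext _ _ fun n => ?_
  have h : (CochainComplex.mappingCone.desc S.f 0 S.g (by simp)).f n =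
      (CochainComplex.mappingCone.snd S.f).v n n (add_zero n) ≫ S.g.f n := by
    simp [CochainComplex.mappingCone.desc_f _ _ _ _ n (n + 1) rfl]
  have hl : (CochainComplex.mappingCone.inl S'.f).v (n + 1) n (by lia) ≫
      (CochainComplex.mappingCone.descShortComplex S').f n = 0 :=
    CochainComplex.mappingCone.inl_v_descShortComplex_f S' _ _ _
  have hr : (CochainComplex.mappingCone.inr S'.f).f n ≫
      (CochainComplex.mappingCone.descShortComplex S').f n = F.map (S.g.f n) :=
    CochainComplex.mappingCone.inr_f_descShortComplex_f S' n
  refine (congrArg F.map h).trans ((F.map_comp _ _).trans ?_)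
  refine Eq.trans ?_ (congrArg
    (· ≫ (CochainComplex.mappingCone.descShortComplex S').f n)
    (CochainComplex.mappingCone.mapHomologicalComplexXIso'_hom S.f F n (n + 1) rfl)).symm
  refine Eq.trans ?_ (Preadditive.add_comp _ _ _ _ _ _).symm
  refine Eq.trans (zero_add _).symm (congrArg₂ (· + ·) ?_ ?_)
  · exact ((Category.assoc _ _ _).trans ((congrArg _ hl).trans comp_zero)).symm
  · exact ((Category.assoc _ _ _).trans (congrArg _ hr)).symm

/-- For an additive functor `F` to an abelian category, if `F` maps a sequence `S` of complexes to a
short exact one, then `F` maps the comparison `cone(S.f) ⟶ S.X₃` to a quasi-isomorphism: `F`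
commutes with mapping cones. -/
lemma quasiIso_map_mappingCone_desc [HasBinaryBiproducts C] (F : C ⥤ D) [F.Additive]
    (S : ShortComplex (CochainComplex C ℤ))
    (hS : (S.map (F.mapHomologicalComplex (.up ℤ))).ShortExact) :
    QuasiIso ((F.mapHomologicalComplex (.up ℤ)).map
      (CochainComplex.mappingCone.desc S.f 0 S.g (by simp))) := by
  have h := CochainComplex.mappingCone.quasiIso_descShortComplex hS
  rw [map_mappingCone_desc F S]
  have h' : QuasiIso (CochainComplex.mappingCone.mapHomologicalComplexIso S.f F).hom :=
    inferInstance
  exact quasiIso_comp _ _ (hφ := h') (hφ' := h)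

lemma shortExact_map_single [HasZeroObject C] (F : C ⥤ D) [F.Additive] (S : ShortComplex C)
    (hS : (S.map F).ShortExact) :
    ((S.map (CochainComplex.singleFunctor C 0)).map
      (F.mapHomologicalComplex (.up ℤ))).ShortExact := by
  let e := HomologicalComplex.singleMapHomologicalComplex F (ComplexShape.up ℤ) 0
  let i : (S.map (CochainComplex.singleFunctor C 0)).map (F.mapHomologicalComplex (.up ℤ)) ≅
      (S.map F).map (HomologicalComplex.single D (ComplexShape.up ℤ) 0) :=
    S.mapNatIso e
  exact ShortComplex.shortExact_of_iso i.symm (hS.map_of_exact _)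

end ConeOfShortExact

section

variable {A : Type u} [Ring A]

/-- A morphism of `K(A-mod)` that becomes a quasi-isomorphism under all `Hom_A(E, -)`, `E` Gorenstein
projective, has a `Gproj`-acyclic cone. -/
lemma gprojAcyclic_trW {K L : HomotopyCategory (FGModuleCat.{u} A) (.up ℤ)} (f : K ⟶ L)
    (hf : ∀ E : FGModuleCat.{u} A, IsGorensteinProjective E →
      HomotopyCategory.quasiIso _ _ ((homComplexFunctor A E).map f)) :
    (gprojAcyclic A).trW f := by
  obtain ⟨Z, g, h, hT⟩ := distinguished_cocone_triangle f
  refine ⟨Z, g, h, hT, fun E hE => ?_⟩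
  have h₁ := hf E hE
  rw [HomotopyCategory.quasiIso_eq_trW_subcategoryAcyclic] at h₁
  exact (ObjectProperty.trW_iff_of_distinguished _ _
    ((homComplexFunctor A E).map_distinguished _ hT)).1 h₁

/-- A sequence of modules that all functors `Hom_A(E, -)`, `E` Gorenstein projective, turn into a
short exact sequence underlies a distinguished triangle of `D^b_gp(A)`: the comparison from the
cone of its first morphism to its third term has a `Gproj`-acyclic cone. -/
theorem exists_distinguished_toDbgp (S : ShortComplex (FGModuleCat.{u} A))
    (hS : ∀ E : FGModuleCat.{u} A, IsGorensteinProjective E →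
      (S.map (preadditiveCoyoneda.obj (Opposite.op E))).ShortExact) :
    ∃ h : (toDbgp A).obj S.X₃ ⟶ ((toDbgp A).obj S.X₁)⟦(1 : ℤ)⟧,
      Triangle.mk ((toDbgp A).map S.f) ((toDbgp A).map S.g) h ∈ distTriang (Dbgp A) := by
  let S' := S.map (CochainComplex.singleFunctor (FGModuleCat.{u} A) 0)
  -- `δ` compares the explicit cone of `S.f` with `S.X₃`; `Z` is an abstract cone inside `K^b`,
  -- isomorphic to the explicit one in `K`, and `φ` is `δ` transported to `Z`.
  let δ := CochainComplex.mappingCone.desc S'.f 0 S'.g (by simp)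
  let P := bounded (FGModuleCat.{u} A)
  let B := boundedSingle (FGModuleCat.{u} A)
  obtain ⟨Z, g, h, hT⟩ := distinguished_cocone_triangle (B.map S.f)
  have hT' := P.ι.map_distinguished _ hT
  let e := isoTriangleOfIso₁₂ _ _ hT'
    (HomotopyCategory.mappingCone_triangleh_distinguished S'.f) (Iso.refl _) (Iso.refl _)
    ((Category.comp_id _).trans (Category.id_comp _).symm)
  let e₃ : P.ι.obj Z ≅ (HomotopyCategory.quotient _ _).obj (CochainComplex.mappingCone S'.f) :=
    Triangle.π₃.mapIso e
  let φ : Z ⟶ B.obj S.X₃ :=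
    P.fullyFaithfulι.preimage (e₃.hom ≫ (HomotopyCategory.quotient _ _).map δ)
  have hφδ : P.ι.map φ = e₃.hom ≫ (HomotopyCategory.quotient _ _).map δ :=
    P.fullyFaithfulι.map_preimage _
  have he : P.ι.map g ≫ e₃.hom =
      (HomotopyCategory.quotient _ _).map (CochainComplex.mappingCone.inr S'.f) :=
    e.hom.comm₂.trans (Category.id_comp _)
  have hφ : g ≫ φ = B.map S.g := by
    apply P.ι.map_injective
    rw [Functor.map_comp, hφδ]
    refine (Category.assoc _ _ _).symm.trans
      ((congrArg (· ≫ (HomotopyCategory.quotient _ _).map δ) he).trans ?_)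
    refine ((HomotopyCategory.quotient _ _).map_comp _ _).symm.trans ?_
    rw [CochainComplex.mappingCone.inr_desc]
    rfl
  have hW : (gprojAcyclicBounded A).trW φ := by
    rw [ObjectProperty.inverseImage_trW_iff, hφδ]
    refine (MorphismProperty.cancel_left_of_respectsIso _ _ _).2 (gprojAcyclic_trW _ fun E hE => ?_)
    have h₁ := quasiIso_map_mappingCone_desc (preadditiveCoyoneda.obj (Opposite.op E)) S'
      (shortExact_map_single _ S (hS E hE))
    exact (HomotopyCategory.quotient_map_mem_quasiIso_iff _).2 h₁
  let Q := (gprojAcyclicBounded A).trW.Q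
  let i : Q.obj Z ≅ (toDbgp A).obj S.X₃ :=
    Localization.isoOfHom Q (gprojAcyclicBounded A).trW φ hW
  have hi : Q.map g ≫ i.hom = (toDbgp A).map S.g :=
    (Q.map_comp g φ).symm.trans (congrArg Q.map hφ)
  refine ⟨i.inv ≫ Q.map h ≫ (Q.commShiftIso (1 : ℤ)).hom.app _,
    isomorphic_distinguished _ (Q.map_distinguished _ hT) _
      (Triangle.isoMk _ _ (Iso.refl _) (Iso.refl _) i.symm ?_ ?_ ?_)⟩
  · exact (Category.comp_id _).trans (Category.id_comp _).symm
  · change (toDbgp A).map S.g ≫ i.inv = 𝟙 _ ≫ Q.map g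
    exact ((Iso.comp_inv_eq i).2 hi.symm).trans (Category.id_comp _).symm
  · change (i.inv ≫ Q.map h ≫ (Q.commShiftIso (1 : ℤ)).hom.app _) ≫
      (shiftFunctor _ (1 : ℤ)).map (𝟙 _) =
        i.inv ≫ Q.map h ≫ (Q.commShiftIso (1 : ℤ)).hom.app _
    exact (congrArg _ (CategoryTheory.Functor.map_id _ _)).trans (Category.comp_id _)

end

/-! ### Levels in triangulated categories -/

section Level

variable {T : Type*} [Category* T]

lemma isClosedUnderBinaryProducts_retractClosure [HasBinaryProducts T] (P : ObjectProperty T)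
    [P.IsClosedUnderBinaryProducts] : P.retractClosure.IsClosedUnderBinaryProducts where
  limitsOfShape_le := by
    rintro X ⟨p⟩
    obtain ⟨Y, hY, ⟨r⟩⟩ := p.prop_diag_obj ⟨WalkingPair.left⟩
    obtain ⟨Z, hZ, ⟨s⟩⟩ := p.prop_diag_obj ⟨WalkingPair.right⟩
    let e : X ≅ p.diag.obj ⟨WalkingPair.left⟩ ⨯ p.diag.obj ⟨WalkingPair.right⟩ :=
      p.isLimit.conePointUniqueUpToIso (limit.isLimit p.diag) ≪≫
        HasLimit.isoOfNatIso (diagramIsoPair p.diag)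
    exact ⟨Y ⨯ Z, P.prop_prod _ _ hY hZ,
      ⟨(Retract.ofIso e).trans ⟨prod.map r.i s.i, prod.map r.r s.r, by simp⟩⟩⟩

variable [HasZeroObject T] [HasShift T ℤ] [Preadditive T]
  [∀ n : ℤ, (shiftFunctor T n).Additive] [Pretriangulated T]

lemma level_zero_isClosedUnderFiniteProducts (M : T) :
    (level M 0).IsClosedUnderFiniteProducts := by
  rw [level, ObjectProperty.triangEnvelopeIter_zero]
  have := isClosedUnderBinaryProducts_retractClosure
    ((ObjectProperty.singleton M).shiftClosure ℤ).binaryProductsClosure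
  exact .mk'

/-- If `Y → N → X → Y[1]` is distinguished with `Y ∈ ⟨M⟩_{n+1}` and `N ∈ ⟨M⟩_1`, then
`X ∈ ⟨M⟩_{n+2}`: rotate, and use that levels are stable under shifts. -/
lemma level_succ_of_distinguished (M : T) (n : ℕ) {t : Triangle T} (ht : t ∈ distTriang T)
    (h₁ : level M n t.obj₁) (h₂ : level M 0 t.obj₂) : level M (n + 1) t.obj₃ := by
  rw [level, ObjectProperty.triangEnvelopeIter_succ]
  refine ObjectProperty.le_retractClosure _ _
    ⟨_, _, _, _, _, rot_of_distTriang _ ht, ?_, (level M n).le_shift 1 _ h₁⟩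
  rwa [level, ObjectProperty.triangEnvelopeIter_zero] at h₂

end Level

/-! ### Modules of finite resolution dimension -/

section

variable {A : Type u} [Ring A]

instance boundedSingle_additive : (boundedSingle (FGModuleCat.{u} A)).Additive where
  map_add := (bounded (FGModuleCat.{u} A)).ι.map_injective
    ((HomotopyCategory.singleFunctor (FGModuleCat.{u} A) 0).map_add)

instance toDbgp_additive : (toDbgp A).Additive :=
  inferInstanceAs (boundedSingle (FGModuleCat.{u} A) ⋙ (gprojAcyclicBounded A).trW.Q).Additive

lemma InAdd.of_retract {M X Y : FGModuleCat.{u} A} (r : Retract X Y) (h : InAdd M Y) :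
    InAdd M X := by
  obtain ⟨n, ⟨s⟩⟩ := h
  exact ⟨n, ⟨r.trans s⟩⟩

lemma InAdd.level_zero {M X : FGModuleCat.{u} A} (h : InAdd M X) :
    level ((toDbgp A).obj M) 0 ((toDbgp A).obj X) := by
  obtain ⟨n, ⟨r⟩⟩ := h
  have := level_zero_isClosedUnderFiniteProducts ((toDbgp A).obj M)
  have h₁ : level ((toDbgp A).obj M) 0 (∏ᶜ fun _ : Fin n => (toDbgp A).obj M) :=
    ObjectProperty.prop_product _ fun _ => ObjectProperty.le_triangEnvelopeIter _ 0 _ (by simp)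
  let e : (toDbgp A).obj (⨁ fun _ : Fin n => M) ≅ ∏ᶜ fun _ : Fin n => (toDbgp A).obj M :=
    (toDbgp A).mapBiproduct _ ≪≫ biproduct.isoProduct _
  exact (level ((toDbgp A).obj M) 0).prop_of_retract ((r.map (toDbgp A)).trans (.ofIso e)) h₁

/-- Lifting along `g` passes from `M` to every object of `add M`. -/
lemma exists_lift_of_inAdd {M E N X : FGModuleCat.{u} A} (hE : InAdd M E) (g : N ⟶ X)
    (hg : ∀ f : M ⟶ X, ∃ f' : M ⟶ N, f' ≫ g = f) (f : E ⟶ X) :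
    ∃ f' : E ⟶ N, f' ≫ g = f := by
  obtain ⟨n, ⟨r⟩⟩ := hE
  choose l hl using fun j => hg (biproduct.ι (fun _ : Fin n => M) j ≫ r.r ≫ f)
  refine ⟨r.i ≫ biproduct.desc l, ?_⟩
  have : biproduct.desc l ≫ g = r.r ≫ f := by
    refine biproduct.hom_ext' _ _ fun j => ?_
    rw [biproduct.ι_desc_assoc, hl]
  rw [Category.assoc, this, r.retract_assoc]

lemma shortExact_coyoneda (E : FGModuleCat.{u} A) (S : ShortComplex (FGModuleCat.{u} A))
    (hf : Function.Injective S.f.hom.hom) (hfg : Function.Exact S.f.hom.hom S.g.hom.hom)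
    (hg : ∀ f : E ⟶ S.X₃, ∃ f' : E ⟶ S.X₂, f' ≫ S.g = f) :
    (S.map (preadditiveCoyoneda.obj (Opposite.op E))).ShortExact := by
  apply ShortComplex.ShortExact.mk'
  · rw [ShortComplex.ab_exact_iff]
    intro (x : E ⟶ S.X₂) (hx : x ≫ S.g = 0)
    have hx' : ∀ e, ∃ y, S.f.hom.hom y = x.hom.hom e := fun e =>
      (hfg _).1 (LinearMap.congr_fun (congrArg (fun t => t.hom.hom) hx) e)
    let j := LinearEquiv.ofInjective S.f.hom.hom hf
    let l : E →ₗ[A] S.X₁ := j.symm.toLinearMap ∘ₗ x.hom.hom.codRestrict _ hx'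
    refine ⟨(FGModuleCat.ofHom l : E ⟶ S.X₁), ?_⟩
    refine FGModuleCat.hom_ext (LinearMap.ext fun e => ?_)
    exact congrArg Subtype.val (j.apply_symm_apply _)
  · rw [AddCommGrpCat.mono_iff_injective]
    intro (x : E ⟶ S.X₁) (y : E ⟶ S.X₁) (h : x ≫ S.f = y ≫ S.f)
    refine FGModuleCat.hom_ext (LinearMap.ext fun e => ?_)
    exact hf (LinearMap.congr_fun (congrArg (fun t => t.hom.hom) h) e)
  · rw [AddCommGrpCat.epi_iff_surjective]
    exact fun x => hg x

/-- The first syzygy: an `M`-resolution of `X` of length `n + 1` breaks up into a sequence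
`0 → Y → M₀ → X` as in the statement and an `M`-resolution of `Y = Ker ε` of length `n`. -/
lemma HasAddResolution.exists_shortComplex [IsNoetherianRing A] {M X : FGModuleCat.{u} A} {n : ℕ}
    (h : HasAddResolution M X (n + 1)) :
    ∃ S : ShortComplex (FGModuleCat.{u} A), S.X₃ = X ∧ InAdd M S.X₂ ∧
      HasAddResolution M S.X₁ n ∧ Function.Injective S.f.hom.hom ∧
      Function.Exact S.f.hom.hom S.g.hom.hom ∧
      ∀ f : M ⟶ S.X₃, ∃ f' : M ⟶ S.X₂, f' ≫ S.g = f := by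
  obtain ⟨K, ε, hK, hK₀, hε, hex₀, hex, hM, hM₀, hM₁⟩ := h
  let Y : FGModuleCat.{u} A := FGModuleCat.of A (LinearMap.ker ε.hom.hom)
  let ι : Y ⟶ K.X 0 := FGModuleCat.ofHom (LinearMap.ker ε.hom.hom).subtype
  have hι : Function.Injective ι.hom.hom := Subtype.val_injective
  have hιε : ι ≫ ε = 0 := by
    ext y
    exact y.2
  let ε' : K.X 1 ⟶ Y := FGModuleCat.ofHom
    ((K.d 1 0).hom.hom.codRestrict (LinearMap.ker ε.hom.hom) fun x => hex₀.apply_apply_eq_zero x)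
  have hε' : ε' ≫ ι = K.d 1 0 := rfl
  have cancel : ∀ {Z : FGModuleCat.{u} A} (a b : Z ⟶ Y), a ≫ ι = b ≫ ι → a = b := by
    intro Z a b hab
    refine FGModuleCat.hom_ext (LinearMap.ext fun z => ?_)
    exact hι (LinearMap.congr_fun (congrArg (fun t => t.hom.hom) hab) z)
  refine ⟨ShortComplex.mk ι ε hιε, rfl, hK 0, ⟨ChainComplex.truncate.obj K, ε',
    fun i => hK (i + 1), fun i hi => hK₀ (i + 1) (by lia), ?_, ?_, fun i => hex (i + 1), ?_, ?_,
    fun i => hM₁ (i + 1)⟩, hι, fun x => ?_, hM⟩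
  · rintro ⟨y, hy⟩
    obtain ⟨z, rfl⟩ := (hex₀ y).1 hy
    exact ⟨z, rfl⟩
  · intro x
    refine Iff.trans ?_ (hex 0 x)
    exact ⟨fun hx => congrArg Subtype.val hx, fun hx => Subtype.ext hx⟩
  · intro (f : M ⟶ Y)
    obtain ⟨g, hg⟩ := hM₀ (f ≫ ι) (by rw [Category.assoc, hιε, comp_zero])
    exact ⟨g, cancel (g ≫ ε') f hg⟩
  · intro (f : M ⟶ K.X 1) (hf : f ≫ ε' = 0)
    exact hM₁ 0 f (show (f ≫ ε') ≫ ι = 0 by rw [hf, zero_comp])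
  · exact ⟨fun hx => ⟨⟨x, hx⟩, rfl⟩, by rintro ⟨y, rfl⟩; exact y.2⟩

lemma HasAddResolution.inAdd {M X : FGModuleCat.{u} A} (h : HasAddResolution M X 0) :
    InAdd M X := by
  obtain ⟨K, ε, hK, hK₀, hε, hex₀, -, hM, -, -⟩ := h
  have h₀ : K.d 1 0 = 0 := (hK₀ 1 one_pos).eq_of_src _ _
  have hinj : Function.Injective ε.hom.hom := by
    rw [injective_iff_map_eq_zero]
    intro x hx
    obtain ⟨y, rfl⟩ := (hex₀ x).1 hx
    rw [h₀]
    rfl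
  let e := (LinearEquiv.ofBijective ε.hom.hom ⟨hinj, hε⟩).toFGModuleCatIso
  exact (hK 0).of_retract (Retract.ofIso (X := X) (Y := K.X 0) e.symm)

theorem HasAddResolution.level [IsNoetherianRing A] {M X : FGModuleCat.{u} A} {n : ℕ}
    (hM : ∀ E : FGModuleCat.{u} A, IsGorensteinProjective E → InAdd M E)
    (h : HasAddResolution M X n) : level ((toDbgp A).obj M) n ((toDbgp A).obj X) := by
  induction n generalizing X with
  | zero => exact h.inAdd.level_zero
  | succ n ih =>
    obtain ⟨S, rfl, h₂, h₁, hf, hfg, hg⟩ := h.exists_shortComplex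
    obtain ⟨w, hw⟩ := exists_distinguished_toDbgp S fun E hE =>
      shortExact_coyoneda E S hf hfg (exists_lift_of_inAdd (hM E hE) S.g hg)
    exact level_succ_of_distinguished _ n hw (ih h₁) h₂.level_zero

lemma HasAddResolution.mono {M X : FGModuleCat.{u} A} {m n : ℕ} (h : HasAddResolution M X m)
    (hmn : m ≤ n) : HasAddResolution M X n := by
  obtain ⟨K, ε, hK, hK₀, h⟩ := h
  exact ⟨K, ε, hK, fun i hi => hK₀ i (hmn.trans_lt hi), h⟩

lemma hasAddResolution_of_resolDim_le {M X : FGModuleCat.{u} A} {n : ℕ} (h : resolDim M X ≤ n) :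
    HasAddResolution M X n := by
  by_contra hn
  have : ((n + 1 : ℕ) : ℕ∞) ≤ resolDim M X :=
    le_iInf₂ fun m hm => Nat.cast_le.2 (not_le.1 fun hmn => hn (hm.mono hmn))
  exact absurd (Nat.cast_le.1 (this.trans h)) (by lia)

theorem dimIn_essImage_le [IsNoetherianRing A] {M : FGModuleCat.{u} A}
    (hM : ∀ E : FGModuleCat.{u} A, IsGorensteinProjective E → InAdd M E) :
    dimIn (toDbgp A).essImage ≤ resolDimAll M := by
  by_cases h : resolDimAll M = ⊤
  · rw [h]
    exact le_top
  · obtain ⟨n, hn⟩ := ENat.ne_top_iff_exists.1 h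
    rw [← hn]
    refine iInf₂_le n ⟨(toDbgp A).obj M, ?_⟩
    rintro Y ⟨X, ⟨e⟩⟩
    refine ObjectProperty.prop_of_iso _ e
      ((hasAddResolution_of_resolDim_le (M := M) (X := X) ?_).level hM)
    exact (le_iSup (fun X => resolDim M X) X).trans hn.ge

end

/-! ### Summands of Gorenstein projective modules -/

section

variable {A : Type u} [Ring A]

/-- There is a short exact sequence `0 → Y → P → Z → 0` with `P` finitely generated projective that
stays exact under `Hom_A(-, Q)` for all finitely generated projective `Q`. Totally acyclic
complexes are spliced from such sequences. -/
def ProjStep (Y Z : FGModuleCat.{u} A) : Prop :=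
  ∃ (P : FGModuleCat.{u} A) (i : Y →ₗ[A] P) (p : P →ₗ[A] Z), Module.Projective A P ∧
    Function.Injective i ∧ Function.Surjective p ∧ Function.Exact i p ∧
    ∀ Q : FGModuleCat.{u} A, Module.Projective A Q → ∀ f : Y →ₗ[A] Q,
      ∃ g : P →ₗ[A] Q, g ∘ₗ i = f

lemma exists_comp_eq_of_ker_le {M N P : Type*} [AddCommGroup M] [Module A M] [AddCommGroup N]
    [Module A N] [AddCommGroup P] [Module A P] (q : M →ₗ[A] N) (hq : Function.Surjective q)
    (h : M →ₗ[A] P) (hh : LinearMap.ker q ≤ LinearMap.ker h) : ∃ u : N →ₗ[A] P, u ∘ₗ q = h := by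
  let e := q.quotKerEquivOfSurjective hq
  refine ⟨(LinearMap.ker q).liftQ h hh ∘ₗ e.symm.toLinearMap, LinearMap.ext fun x => ?_⟩
  have : e.symm (q x) = (LinearMap.ker q).mkQ x := by
    rw [LinearEquiv.symm_apply_eq]
    rfl
  simp [this]

lemma exists_comp_eq_of_mem_range {M N P : Type*} [AddCommGroup M] [Module A M] [AddCommGroup N]
    [Module A N] [AddCommGroup P] [Module A P] (j : M →ₗ[A] N) (hj : Function.Injective j)
    (h : P →ₗ[A] N) (hh : ∀ x, h x ∈ LinearMap.range j) : ∃ c : P →ₗ[A] M, j ∘ₗ c = h := by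
  let e := LinearEquiv.ofInjective j hj
  exact ⟨e.symm.toLinearMap ∘ₗ h.codRestrict _ hh,
    LinearMap.ext fun x => congrArg Subtype.val (e.apply_symm_apply _)⟩

/-- A relation that is total on both sides admits a bi-infinite chain through every point. -/
lemma exists_int_chain {α : Type*} (R : α → α → Prop) (hr : ∀ x, ∃ y, R x y)
    (hl : ∀ x, ∃ y, R y x) (x : α) : ∃ z : ℤ → α, z 0 = x ∧ ∀ i, R (z i) (z (i + 1)) := by
  choose r hr using hr
  choose l hl using hl
  let z : ℤ → α
    | .ofNat n => r^[n] x
    | .negSucc n => l^[n + 1] x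
  refine ⟨z, rfl, ?_⟩
  rintro (n | n)
  · change R (r^[n] x) (r^[n + 1] x)
    rw [Function.iterate_succ_apply']
    exact hr _
  · obtain _ | n := n
    · exact hl x
    · change R (l^[n + 2] x) (l^[n + 1] x)
      rw [Function.iterate_succ_apply']
      exact hl _

/-- Splicing short exact sequences `0 → Z i → P i → Z (i + 1) → 0` gives a totally acyclic complex
with `Z 0 ≅ Ker d⁰`. -/
theorem isGorensteinProjective_of_chain (Z : ℤ → FGModuleCat.{u} A)
    (hZ : ∀ i, ProjStep (Z i) (Z (i + 1))) : IsGorensteinProjective (Z 0) := by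
  choose P ι p hP hι hp hex hext using hZ
  let d : ∀ n : ℤ, P n ⟶ P (n + 1) := fun n => FGModuleCat.ofHom (ι (n + 1) ∘ₗ p n)
  have hd : ∀ n, d n ≫ d (n + 1) = 0 := fun n => by
    refine FGModuleCat.hom_ext (LinearMap.ext fun x => ?_)
    change ι _ (p _ (ι _ (p _ x))) = 0
    rw [(hex (n + 1)).apply_apply_eq_zero, map_zero]
  let K := CochainComplex.of P d hd
  have hK : ∀ n, K.d n (n + 1) = d n := fun n => CochainComplex.of_d P d n
  refine ⟨K, ⟨hP, ?_, ?_⟩, ⟨?_⟩⟩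
  · rintro i _ _ rfl rfl
    rw [hK, hK]
    intro y
    constructor
    · intro (hy : ι _ (p _ y) = 0)
      obtain ⟨z, rfl⟩ := (hex _ y).1 (hι _ (hy.trans (map_zero _).symm))
      obtain ⟨w, rfl⟩ := hp _ z
      exact ⟨w, rfl⟩
    · rintro ⟨w, rfl⟩
      exact LinearMap.congr_fun (congrArg (fun t => t.hom.hom) (hd i)) w
  · rintro Q hQ i _ _ rfl rfl f hf
    rw [hK] at hf ⊢
    have h₁ : ∀ z : Z (i + 1), f.hom.hom (ι _ z) = 0 := fun z => by
      obtain ⟨w, rfl⟩ := hp _ z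
      exact LinearMap.congr_fun (congrArg (fun t => t.hom.hom) hf) w
    obtain ⟨v, hv⟩ := exists_comp_eq_of_ker_le (p (i + 1)) (hp _) f.hom.hom fun y hy => by
      obtain ⟨z, rfl⟩ := (hex _ y).1 hy
      exact h₁ z
    obtain ⟨g, hg⟩ := hext _ Q hQ v
    refine ⟨(FGModuleCat.ofHom g : P (i + 1 + 1) ⟶ Q), ?_⟩
    refine FGModuleCat.hom_ext (LinearMap.ext fun x => ?_)
    exact (LinearMap.congr_fun hg _).trans (LinearMap.congr_fun hv x)
  · rw [show K.d 0 1 = d 0 from hK 0]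
    refine (LinearEquiv.ofInjective (ι 0) (hι 0)).trans (LinearEquiv.ofEq _ _ ?_)
    ext y
    constructor
    · rintro ⟨z, rfl⟩
      change ι _ (p _ (ι _ z)) = 0
      rw [(hex 0).apply_apply_eq_zero, map_zero]
    · intro (hy : ι _ (p _ y) = 0)
      exact (hex _ y).1 (hι _ (hy.trans (map_zero _).symm))

/-- The module of cycles `Ker dⁱ` of a complex of finitely generated modules. -/
abbrev cycles [IsNoetherianRing A] (P : CochainComplex (FGModuleCat.{u} A) ℤ) (i : ℤ) : FGModuleCat.{u} A :=
  FGModuleCat.of A (LinearMap.ker (P.d i (i + 1)).hom.hom)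

lemma IsTotallyAcyclic.projStep_cycles [IsNoetherianRing A] {P : CochainComplex (FGModuleCat.{u} A) ℤ}
    (hP : IsTotallyAcyclic P) (i : ℤ) : ProjStep (cycles P i) (cycles P (i + 1)) := by
  have hex := hP.exact i (i + 1) (i + 1 + 1) rfl rfl
  refine ⟨P.X i, (LinearMap.ker (P.d i (i + 1)).hom.hom).subtype,
    (P.d i (i + 1)).hom.hom.codRestrict (LinearMap.ker (P.d (i + 1) (i + 1 + 1)).hom.hom)
      (fun x => hex.apply_apply_eq_zero x), hP.projective i, Subtype.val_injective, ?_, ?_, ?_⟩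
  · rintro ⟨y, hy⟩
    obtain ⟨x, rfl⟩ := (hex y).1 hy
    exact ⟨x, rfl⟩
  · intro x
    exact ⟨fun hx => ⟨⟨x, congrArg Subtype.val hx⟩, rfl⟩,
      by rintro ⟨y, rfl⟩; exact Subtype.ext y.2⟩
  · intro Q hQ f
    -- `f` on `Ker dⁱ` is composed with the surjection from `P.X (i - 1)`, and the composite
    -- extended along `dⁱ⁻¹`.
    obtain ⟨j, rfl⟩ : ∃ j, i = j + 1 := ⟨i - 1, by lia⟩
    have hex' := hP.exact j (j + 1) (j + 1 + 1) rfl rfl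
    have hex'' := hP.exact (j - 1) j (j + 1) (by lia) rfl
    let π : P.X j →ₗ[A] LinearMap.ker (P.d (j + 1) (j + 1 + 1)).hom.hom :=
      (P.d j (j + 1)).hom.hom.codRestrict _ (fun x => hex'.apply_apply_eq_zero x)
    let F : P.X j ⟶ Q := FGModuleCat.ofHom (f ∘ₗ π)
    obtain ⟨g, hg⟩ := hP.hom_exact Q hQ (j - 1) j (j + 1) (by lia) rfl F (by
      refine FGModuleCat.hom_ext (LinearMap.ext fun x => ?_)
      have : π ((P.d (j - 1) j).hom.hom x) = 0 := Subtype.ext (hex''.apply_apply_eq_zero x)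
      exact (congrArg f this).trans (map_zero f))
    refine ⟨g.hom.hom, LinearMap.ext ?_⟩
    rintro ⟨y, hy⟩
    obtain ⟨x, rfl⟩ := (hex' y).1 hy
    exact LinearMap.congr_fun (congrArg (fun t => t.hom.hom) hg) x

lemma ProjStep.prod_left {G G' : FGModuleCat.{u} A} (h : ProjStep G G') (Q : FGModuleCat.{u} A)
    (hQ : Module.Projective A Q) : ProjStep (FGModuleCat.of A (G × Q)) G' := by
  obtain ⟨P, j, q, hP, hj, hq, hex, hext⟩ := h
  refine ⟨FGModuleCat.of A (P × Q), j.prodMap LinearMap.id, q ∘ₗ LinearMap.fst A P Q,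
    inferInstanceAs (Module.Projective A (P × Q)), ?_, ?_, ?_, ?_⟩
  · exact hj.prodMap Function.injective_id
  · exact hq.comp Prod.fst_surjective
  · rintro ⟨x, y⟩
    refine (hex x).trans ⟨?_, ?_⟩
    · rintro ⟨z, rfl⟩
      exact ⟨(z, y), rfl⟩
    · rintro ⟨⟨z, w⟩, hz⟩
      exact ⟨z, congrArg Prod.fst hz⟩
  · intro R hR f
    obtain ⟨g, hg⟩ := hext R hR (f ∘ₗ LinearMap.inl A G Q)
    refine ⟨g.coprod (f ∘ₗ LinearMap.inr A G Q), LinearMap.ext fun ⟨x, y⟩ => ?_⟩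
    change g (j x) + f (0, y) = f (x, y)
    rw [show g (j x) = f (x, 0) from LinearMap.congr_fun hg x, ← map_add]
    simp

lemma ProjStep.prod_right {G G' : FGModuleCat.{u} A} (h : ProjStep G G') (Q : FGModuleCat.{u} A)
    (hQ : Module.Projective A Q) : ProjStep G (FGModuleCat.of A (G' × Q)) := by
  obtain ⟨P, j, q, hP, hj, hq, hex, hext⟩ := h
  refine ⟨FGModuleCat.of A (P × Q), LinearMap.inl A P Q ∘ₗ j, q.prodMap LinearMap.id,
    inferInstanceAs (Module.Projective A (P × Q)), ?_, ?_, ?_, ?_⟩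
  · exact LinearMap.inl_injective.comp hj
  · exact hq.prodMap Function.surjective_id
  · rintro ⟨x, y⟩
    constructor
    · intro hz
      obtain ⟨z, rfl⟩ := (hex x).1 (congrArg Prod.fst hz)
      exact ⟨z, Prod.ext rfl (congrArg Prod.snd hz).symm⟩
    · rintro ⟨z, hz⟩
      rw [← hz]
      exact Prod.ext (hex.apply_apply_eq_zero z) rfl
  · intro R hR f
    obtain ⟨g, hg⟩ := hext R hR f
    exact ⟨g ∘ₗ LinearMap.fst A P Q, hg⟩

/-- If `0 → G → P → G' → 0` is as in `ProjStep` and `X` is a summand of `G`, then so is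
`0 → X → P → P/X → 0`, and by a Schanuel argument `P/X` is a summand of `G' × P`. -/
lemma ProjStep.exists_right_of_retract {G G' X : FGModuleCat.{u} A} (h : ProjStep G G')
    (s : X →ₗ[A] G) (r : G →ₗ[A] X) (hrs : ∀ x, r (s x) = x) :
    ∃ X' : FGModuleCat.{u} A, ProjStep X X' ∧ ∃ P : FGModuleCat.{u} A, Module.Projective A P ∧
      ∃ (s' : X' →ₗ[A] G' × P) (r' : G' × P →ₗ[A] X'), ∀ x, r' (s' x) = x := by
  obtain ⟨P, j, q, hP, hj, hq, hex, hext⟩ := h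
  let N := LinearMap.range (j ∘ₗ s)
  -- `β` extends the projection of `G` onto the complement of `X` to an endomorphism of `P`.
  obtain ⟨β, hβ⟩ := hext P hP (j ∘ₗ (LinearMap.id - s ∘ₗ r))
  replace hβ : ∀ g, β (j g) = j g - j (s (r g)) := fun g =>
    (LinearMap.congr_fun hβ g).trans (map_sub j _ _)
  refine ⟨FGModuleCat.of A (P ⧸ N), ⟨P, j ∘ₗ s, N.mkQ, hP, ?_, N.mkQ_surjective, ?_, ?_⟩,
    P, hP, ?_⟩
  · exact hj.comp (Function.LeftInverse.injective hrs)
  · intro x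
    exact Submodule.Quotient.mk_eq_zero N
  · intro Q hQ f
    obtain ⟨g, hg⟩ := hext Q hQ (f ∘ₗ r)
    refine ⟨g, LinearMap.ext fun x => ?_⟩
    exact (LinearMap.congr_fun hg (s x)).trans (congrArg f (hrs x))
  · obtain ⟨v, hv⟩ := exists_comp_eq_of_ker_le q hq (N.mkQ ∘ₗ (LinearMap.id - β)) fun y hy => by
      obtain ⟨g, rfl⟩ := (hex y).1 hy
      refine (Submodule.Quotient.mk_eq_zero N).2 ⟨r g, ?_⟩
      change j (s (r g)) = j g - β (j g)
      rw [hβ, sub_sub_cancel]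
    refine ⟨N.liftQ (q.prod (-β)) ?_, v.coprod (-N.mkQ), fun x => ?_⟩
    · rintro _ ⟨x, rfl⟩
      refine Prod.ext (hex.apply_apply_eq_zero _) ?_
      change -β (j (s x)) = 0
      rw [hβ, hrs, sub_self, neg_zero]
    · obtain ⟨y, rfl⟩ := N.mkQ_surjective x
      change v (q y) + -N.mkQ (-β y) = N.mkQ y
      rw [show v (q y) = N.mkQ (y - β y) from LinearMap.congr_fun hv y, ← map_neg, ← map_add]
      congr 1
      abel

/-- If `0 → G' → P → G → 0` is as in `ProjStep` and `X` is a summand of `G`, then so is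
`0 → N → P → X → 0`, with `N` the kernel of `P → G → X`, and by a Schanuel argument `N` is a
summand of `G' × P`. -/
lemma ProjStep.exists_left_of_retract [IsNoetherianRing A] {G G' X : FGModuleCat.{u} A} (h : ProjStep G' G)
    (s : X →ₗ[A] G) (r : G →ₗ[A] X) (hrs : ∀ x, r (s x) = x) :
    ∃ X' : FGModuleCat.{u} A, ProjStep X' X ∧ ∃ P : FGModuleCat.{u} A, Module.Projective A P ∧
      ∃ (s' : X' →ₗ[A] G' × P) (r' : G' × P →ₗ[A] X'), ∀ x, r' (s' x) = x := by
  obtain ⟨P, j, q, hP, hj, hq, hex, hext⟩ := h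
  let N := LinearMap.ker (r ∘ₗ q)
  -- `β` lifts the projection of `G` onto the complement of `X` to an endomorphism of `P`; its image
  -- lies in `N`, and `x - β x` lies in `G'` for `x ∈ N`.
  obtain ⟨β, hβ⟩ := Module.projective_lifting_property q ((LinearMap.id - s ∘ₗ r) ∘ₗ q) hq
  replace hβ : ∀ y, q (β y) = q y - s (r (q y)) := fun y => LinearMap.congr_fun hβ y
  let β' : P →ₗ[A] N := β.codRestrict N fun y => by
    change r (q (β y)) = 0
    rw [hβ, map_sub, hrs, sub_self]
  let j' : G' →ₗ[A] N := j.codRestrict N fun z => by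
    change r (q (j z)) = 0
    rw [hex.apply_apply_eq_zero, map_zero]
  obtain ⟨c, hc⟩ := exists_comp_eq_of_mem_range j hj (N.subtype - β ∘ₗ N.subtype) fun x =>
    (hex _).1 (by
      have hx : r (q x) = 0 := x.2
      change q (x - β x) = 0
      rw [map_sub, hβ, hx, map_zero, sub_zero, sub_self])
  have hc' : ∀ x : N, j' (c x) = x - β' x := fun x => Subtype.ext (LinearMap.congr_fun hc x)
  refine ⟨FGModuleCat.of A N, ⟨P, N.subtype, r ∘ₗ q, hP, Subtype.val_injective, ?_, ?_, ?_⟩,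
    P, hP, c.prod N.subtype, j'.coprod β', fun x => ?_⟩
  · exact (Function.RightInverse.surjective hrs).comp hq
  · intro x
    exact ⟨fun hx => ⟨⟨x, hx⟩, rfl⟩, by rintro ⟨y, rfl⟩; exact y.2⟩
  · intro Q hQ f
    let f' : N →ₗ[A] Q := f
    obtain ⟨h, hh⟩ := hext Q hQ (f' ∘ₗ j')
    replace hh : ∀ z, h (j' z) = f' (j' z) := fun z => LinearMap.congr_fun hh z
    refine ⟨h + (f' - h ∘ₗ N.subtype) ∘ₗ β', LinearMap.ext fun x : N => ?_⟩
    change h x + (f' (β' x) - h (β' x)) = f' x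
    have h₁ := hh (c x)
    rw [hc', map_sub, AddSubgroupClass.coe_sub, map_sub] at h₁
    rw [← sub_eq_zero]
    rw [← sub_eq_zero] at h₁
    rw [← h₁]
    abel
  · change j' (c x) + β' x = x
    rw [hc', sub_add_cancel]

/-- Summands of Gorenstein projective modules are Gorenstein projective. The class of summands of
modules `Ker dⁱ × Q`, with `d` the differential of a totally acyclic complex and `Q` projective, has
the sequences of `ProjStep` on both sides, hence consists of Gorenstein projective modules. -/
theorem isGorensteinProjective_of_retract [IsNoetherianRing A] {G X : FGModuleCat.{u} A}
    (hG : IsGorensteinProjective G) (r : Retract X G) : IsGorensteinProjective X := by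
  let C : Set (FGModuleCat.{u} A) := {X | ∃ P : CochainComplex (FGModuleCat.{u} A) ℤ,
    IsTotallyAcyclic P ∧ ∃ (i : ℤ) (Q : FGModuleCat.{u} A), Module.Projective A Q ∧
      ∃ (s : X →ₗ[A] cycles P i × Q) (r : cycles P i × Q →ₗ[A] X), ∀ x, r (s x) = x}
  have hX : X ∈ C := by
    obtain ⟨P, hP, ⟨e⟩⟩ := hG
    -- Any projective serves as `Q` here.
    refine ⟨P, hP, 0, P.X 0, hP.projective 0,
      LinearMap.inl A _ _ ∘ₗ e.toLinearMap ∘ₗ r.i.hom.hom,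
      r.r.hom.hom ∘ₗ e.symm.toLinearMap ∘ₗ LinearMap.fst A _ _, fun x => ?_⟩
    change r.r.hom.hom (e.symm (e (r.i.hom.hom x))) = x
    rw [e.symm_apply_apply]
    exact LinearMap.congr_fun (congrArg (fun t => t.hom.hom) r.retract) x
  obtain ⟨Z, hZ₀, hZ⟩ := exists_int_chain (fun Y Z : C => ProjStep Y.1 Z.1) (by
    rintro ⟨Y, P, hP, i, Q, hQ, s, r, hrs⟩
    obtain ⟨Y', hY', Q', hQ', s', r', hrs'⟩ :=
      ((hP.projStep_cycles i).prod_left Q hQ).exists_right_of_retract s r hrs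
    exact ⟨⟨Y', P, hP, i + 1, Q', hQ', s', r', hrs'⟩, hY'⟩) (by
    rintro ⟨Y, P, hP, i, Q, hQ, s, r, hrs⟩
    obtain ⟨i, rfl⟩ : ∃ j, i = j + 1 := ⟨i - 1, by lia⟩
    obtain ⟨Y', hY', Q', hQ', s', r', hrs'⟩ :=
      ((hP.projStep_cycles i).prod_right Q hQ).exists_left_of_retract s r hrs
    exact ⟨⟨Y', P, hP, i, Q', hQ', s', r', hrs'⟩, hY'⟩) ⟨X, hX⟩
  have := isGorensteinProjective_of_chain (fun i => (Z i).1) hZ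
  rwa [hZ₀] at this

end

/-! ### Decomposition of Gorenstein projective modules -/

section

variable {A : Type u} [Ring A]

lemma inAdd_of_sum_comp_eq_id {M X : FGModuleCat.{u} A} {J : Type*} [Fintype J]
    (a : J → (X ⟶ M)) (b : J → (M ⟶ X)) (h : ∑ j, a j ≫ b j = 𝟙 X) : InAdd M X := by
  let e := Fintype.equivFin J
  refine ⟨Fintype.card J, ⟨biproduct.lift fun i => a (e.symm i),
    biproduct.desc fun i => b (e.symm i), ?_⟩⟩
  rw [biproduct.lift_desc, ← h]
  exact e.symm.sum_comp fun j => a j ≫ b j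

lemma InAdd.exists_sum_comp_eq_id {M X : FGModuleCat.{u} A} (h : InAdd M X) :
    ∃ (n : ℕ) (a : Fin n → (X ⟶ M)) (b : Fin n → (M ⟶ X)), ∑ j, a j ≫ b j = 𝟙 X := by
  obtain ⟨n, ⟨r⟩⟩ := h
  refine ⟨n, fun j => r.i ≫ biproduct.π _ j, fun j => biproduct.ι (fun _ : Fin n => M) j ≫ r.r, ?_⟩
  have := congrArg (fun t => r.i ≫ t ≫ r.r) (biproduct.total (f := fun _ : Fin n => M))
  simpa only [Preadditive.sum_comp, Preadditive.comp_sum, Category.assoc, Category.id_comp,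
    r.retract] using this

lemma InAdd.trans {M N X : FGModuleCat.{u} A} (h : InAdd M N) (h' : InAdd N X) : InAdd M X := by
  obtain ⟨m, a, b, hab⟩ := h.exists_sum_comp_eq_id
  obtain ⟨n, c, d, hcd⟩ := h'.exists_sum_comp_eq_id
  refine inAdd_of_sum_comp_eq_id (J := Fin n × Fin m) (fun j => c j.1 ≫ a j.2)
    (fun j => b j.2 ≫ d j.1) ?_
  rw [Fintype.sum_prod_type, ← hcd]
  refine Finset.sum_congr rfl fun i _ => ?_
  have := congrArg (fun t => c i ≫ t ≫ d i) hab
  simpa [Preadditive.sum_comp, Preadditive.comp_sum] using this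

lemma InAdd.biprod {M X Y : FGModuleCat.{u} A} (hX : InAdd M X) (hY : InAdd M Y) :
    InAdd M (X ⊞ Y) := by
  obtain ⟨m, a, b, hab⟩ := hX.exists_sum_comp_eq_id
  obtain ⟨n, c, d, hcd⟩ := hY.exists_sum_comp_eq_id
  refine inAdd_of_sum_comp_eq_id (J := Fin m ⊕ Fin n)
    (Sum.elim (fun i => biprod.fst ≫ a i) fun i => biprod.snd ≫ c i)
    (Sum.elim (fun i => b i ≫ biprod.inl) fun i => d i ≫ biprod.inr) ?_
  have h₁ := congrArg (fun t => (biprod.fst : X ⊞ Y ⟶ X) ≫ t ≫ (biprod.inl : X ⟶ X ⊞ Y)) hab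
  have h₂ := congrArg (fun t => (biprod.snd : X ⊞ Y ⟶ Y) ≫ t ≫ (biprod.inr : Y ⟶ X ⊞ Y)) hcd
  simp only [Preadditive.sum_comp, Preadditive.comp_sum, Category.assoc, Category.id_comp]
    at h₁ h₂
  simp only [Fintype.sum_sum_type, Sum.elim_inl, Sum.elim_inr, Category.assoc, h₁, h₂,
    biprod.total]

lemma inAdd_of_isZero {M X : FGModuleCat.{u} A} (h : IsZero X) : InAdd M X :=
  ⟨0, ⟨0, 0, h.eq_of_src _ _⟩⟩

lemma subsingleton_iff_isZero (X : FGModuleCat.{u} A) : Subsingleton X ↔ IsZero X := by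
  constructor
  · intro h
    rw [IsZero.iff_id_eq_zero]
    exact FGModuleCat.hom_ext (LinearMap.ext fun x => Subsingleton.elim _ _)
  · intro h
    exact ⟨fun x y => by
      have := LinearMap.congr_fun (congrArg (fun t => t.hom.hom) (h.eq_of_src (𝟙 X) 0))
      exact (this x).trans (this y).symm⟩

lemma length_biprod (X Y : FGModuleCat.{u} A) :
    Module.length A ↥(X ⊞ Y) = Module.length A X + Module.length A Y := by
  have h₁ : ∀ x : X, (biprod.fst : X ⊞ Y ⟶ X).hom.hom ((biprod.inl : X ⟶ X ⊞ Y).hom.hom x) = x :=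
    LinearMap.congr_fun (congrArg (fun t => t.hom.hom) (biprod.inl_fst (X := X) (Y := Y)))
  have h₂ : ∀ y : Y, (biprod.snd : X ⊞ Y ⟶ Y).hom.hom ((biprod.inr : Y ⟶ X ⊞ Y).hom.hom y) = y :=
    LinearMap.congr_fun (congrArg (fun t => t.hom.hom) (biprod.inr_snd (X := X) (Y := Y)))
  have h₃ : ∀ x : X, (biprod.snd : X ⊞ Y ⟶ Y).hom.hom ((biprod.inl : X ⟶ X ⊞ Y).hom.hom x) = 0 :=
    LinearMap.congr_fun (congrArg (fun t => t.hom.hom) (biprod.inl_snd (X := X) (Y := Y)))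
  have h₄ : ∀ z : ↥(X ⊞ Y), (biprod.inl : X ⟶ X ⊞ Y).hom.hom ((biprod.fst : X ⊞ Y ⟶ X).hom.hom z) +
      (biprod.inr : Y ⟶ X ⊞ Y).hom.hom ((biprod.snd : X ⊞ Y ⟶ Y).hom.hom z) = z :=
    LinearMap.congr_fun (congrArg (fun t => t.hom.hom) (biprod.total (X := X) (Y := Y)))
  refine Module.length_eq_add_of_exact (biprod.inl : X ⟶ X ⊞ Y).hom.hom
    (biprod.snd : X ⊞ Y ⟶ Y).hom.hom (Function.LeftInverse.injective h₁)
    (Function.RightInverse.surjective h₂) fun z =>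
      ⟨fun hz => ⟨(biprod.fst : X ⊞ Y ⟶ X).hom.hom z, ?_⟩, ?_⟩
  · have := h₄ z
    rwa [hz, map_zero, add_zero] at this
  · rintro ⟨x, rfl⟩
    exact h₃ x

/-- Every Gorenstein projective module lies in `add G`, by induction on its length: a decomposable
one splits into two shorter modules, which are Gorenstein projective as summands. -/
theorem inAdd_of_isGorensteinProjective [IsArtinianRing A] {s : ℕ} {G : Fin s → FGModuleCat.{u} A}
    (hG : IsIndecGprojList G) (E : FGModuleCat.{u} A) (hE : IsGorensteinProjective E) :
    InAdd (⨁ G) E := by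
  induction h : (Module.length A E).toNat using Nat.strong_induction_on generalizing E with
  | _ n ih =>
    by_cases h₀ : IsZero E
    · exact inAdd_of_isZero h₀
    by_cases hI : Indecomposable E
    · obtain ⟨i, ⟨e⟩⟩ := hG.exists_iso E hE hI
      have hi : InAdd (⨁ G) (G i) := inAdd_of_sum_comp_eq_id (J := Unit)
        (fun _ => biproduct.ι G i) (fun _ => biproduct.π G i) (by simp)
      exact hi.of_retract (.ofIso e)
    · have : ∃ Y Z : FGModuleCat.{u} A, Nonempty (E ≅ Y ⊞ Z) ∧ ¬ IsZero Y ∧ ¬ IsZero Z := by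
        by_contra! hYZ
        exact hI ⟨h₀, fun Y Z e => or_iff_not_imp_left.2 (hYZ Y Z ⟨e⟩)⟩
      obtain ⟨Y, Z, ⟨e⟩, hY, hZ⟩ := this
      have hlen : Module.length A E = Module.length A Y + Module.length A Z :=
        (FGModuleCat.isoToLinearEquiv e).length_eq.trans (length_biprod Y Z)
      have hpos : ∀ W : FGModuleCat.{u} A, ¬ IsZero W → (Module.length A W).toNat ≠ 0 := by
        intro W hW h₁
        rw [ENat.toNat_eq_zero, Module.length_eq_zero_iff, subsingleton_iff_isZero] at h₁
        exact h₁.elim hW Module.length_ne_top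
      have hadd : (Module.length A E).toNat =
          (Module.length A Y).toNat + (Module.length A Z).toNat := by
        rw [hlen, ENat.toNat_add Module.length_ne_top Module.length_ne_top]
      have rY : Retract Y E := (⟨biprod.inl, biprod.fst, by simp⟩ : Retract Y (Y ⊞ Z)).trans
        (.ofIso e.symm)
      have rZ : Retract Z E := (⟨biprod.inr, biprod.snd, by simp⟩ : Retract Z (Y ⊞ Z)).trans
        (.ofIso e.symm)
      have hpY := hpos Y hY
      have hpZ := hpos Z hZ
      exact ((ih _ (by lia) Y (isGorensteinProjective_of_retract hE rY) rfl).biprod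
        (ih _ (by lia) Z (isGorensteinProjective_of_retract hE rZ) rfl)).of_retract (.ofIso e)

end

end GorensteinDim

end

open GorensteinDim
theorem theorem4p5 (k : Type u) [Field k] (A : Type u) [Ring A] [Algebra k A]
    [Module.Finite k A] (hA : IsFiniteCMType A) :
    (∀ M : FGModuleCat.{u} A, IsGorensteinAuslanderGenerator k hA M →
      ∀ (X : FGModuleCat.{u} A) (n : ℕ), resolDim M X ≤ n →
        level ((toDbgp A).obj M) n ((toDbgp A).obj X)) ∧
    dimIn (toDbgp A).essImage + 2 ≤ grepdim k hA := by
  have : IsArtinianRing A := .of_finite k A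
  have hadd : ∀ M : FGModuleCat.{u} A, InAdd M (hA.gprojSum ⊞ nakayama k hA.gprojSum) →
      ∀ E : FGModuleCat.{u} A, IsGorensteinProjective E → InAdd M E := fun M hM E hE =>
    (hM.of_retract ⟨biprod.inl, biprod.fst, by simp⟩).trans
      (inAdd_of_isGorensteinProjective hA.choose_spec.choose_spec E hE)
  refine ⟨fun M hM X n hX => (hasAddResolution_of_resolDim_le hX).level (hadd M hM.1), ?_⟩
  exact add_le_add_left (le_iInf₂ fun M hM => dimIn_essImage_le (hadd M hM)) 2
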